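/- For $i\in\{1,2\}$ let $\Sigma_i$ be the linear system $$\dot x_i=A_ix_i+B_iu_i+E_id_i,\quad x_i(0)=x_{i,0},\qquad y_i=C_ix_i,$$ with real matrices, $x_i\in\mathbb R^{n_i}$, $u_i\in\mathbb R^{m}$, $d_i\in\mathbb R^{q_i}$, $y_i\in\mathbb R^{p}$; the matrices $A_i$ need not be Hurwitz and the initial conditions are arbitrary. Write $\mathcal L_2$ for the square-integrable signals on $[0,\infty)$, $\|u\|^2=\int_0^\infty|u(t)|^2\,dt$, and $\operatorname{col}(a,b)$ for the stacked vector. For $\gamma,\delta>0$, the system $\Sigma_2$ is called $(\gamma,\delta)$-similar to $\Sigma_1$ if there exist constants $\epsilon,\eta,\mu>0$ and a matrix $K\succ0$ such that for all initial conditions $x_{1,0},x_{2,0}$, all inputs $u_1,u_2\in\mathcal L_2$ and every disturbance $d_1\in\mathcal L_2$ there exists a disturbance $d_2\in\mathcal L_2$ for which $y_1-y_2\in\mathcal L_2$ and $$\|y_1-y_2\|^2\le\gamma\|u_1-u_2\|^2+(\delta-\epsilon)\|\operatorname{col}(u_1,u_2)\|^2+(\mu-\epsilon)\|d_1\|^2-\eta\|d_2\|^2+x_s^\top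 Kx_s,\qquad x_s=\operatorname{col}(x_{1,0},x_{2,0}).$$ Put $$A=\begin{bmatrix}A_1&0\\0&A_2\end{bmatrix},\quad B=\begin{bmatrix}0\\E_2\end{bmatrix},\quad E=\begin{bmatrix}B_1&0&E_1\\0&B_2&0\end{bmatrix},\quad C=\begin{bmatrix}C_1&-C_2\\0&0\end{bmatrix},\quad D=\begin{bmatrix}0\\I\end{bmatrix},$$ $$Q=\begin{bmatrix}(\gamma+\delta)I&-\gamma I&0\\-\gamma I&(\gamma+\delta)I&0\\0&0&\mu I\end{bmatrix},\qquad R=\begin{bmatrix}I&0\\0&\eta I\end{bmatrix}.$$ Let $\gamma,\delta>0$. If there exist a positive definite matrix $X$, a matrix $\Pi$ and scalars $\eta,\mu>0$ such that $$\begin{bmatrix}AX+B\Pi+(AX+B\Pi)^\top&E&(CX+D\Pi)^\top\\E^\top&-Q&0\\CX+D\Pi&0&-R\end{bmatrix}\prec0,$$ then $\Sigma_2$ is $(\gamma,\delta)$-similar to $\Sigma_1$. No assumption on the zeros of the composite system $\dot x=Ax+Bd_2+Ew$, $z=Cx+Dd_2$ is made; in particular the implication holds when this system has no zeros on the imaginary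 axis. -/

import Mathlib

open MeasureTheory Matrix

noncomputable section

/-- A linear time-invariant system `ẋ = A x + B u + E d`, `y = C x`, with state dimension `n`,
input dimension `m`, disturbance dimension `q` and output dimension `p`.
No stability is required. -/
structure LTISystem (n m q p : ℕ) where
  A : Matrix (Fin n) (Fin n) ℝ
  B : Matrix (Fin n) (Fin m) ℝ
  E : Matrix (Fin n) (Fin q) ℝ
  C : Matrix (Fin p) (Fin n) ℝ

/-- The stacked vector `col(x, y)`. -/
def stack {ι κ : Type} (x : EuclideanSpace ℝ ι) (y : EuclideanSpace ℝ κ) :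
    EuclideanSpace ℝ (ι ⊕ κ) :=
  WithLp.toLp 2 (Sum.elim (fun i => x i) (fun j => y j))

/-- `u ∈ 𝓛₂`: the signal `u` is square integrable on `[0, ∞)`. The values of a signal at negative
times are irrelevant. -/
def IsL2 {ι : Type} [Fintype ι] (u : ℝ → EuclideanSpace ℝ ι) : Prop :=
  MemLp u 2 (volume.restrict (Set.Ici (0 : ℝ)))

/-- The squared norm `‖u‖² = ∫₀^∞ |u(t)|² dt` of a signal. -/
def l2NormSq {ι : Type} [Fintype ι] (u : ℝ → EuclideanSpace ℝ ι) : ℝ :=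
  ∫ t in Set.Ici (0 : ℝ), ‖u t‖ ^ 2

namespace LTISystem

variable {n m q p : ℕ}

/-- The right-hand side `A x + B u + E d` of the state equation. -/
def vectorField (S : LTISystem n m q p) (x : EuclideanSpace ℝ (Fin n))
    (u : EuclideanSpace ℝ (Fin m)) (d : EuclideanSpace ℝ (Fin q)) : EuclideanSpace ℝ (Fin n) :=
  S.A.toEuclideanLin x + S.B.toEuclideanLin u + S.E.toEuclideanLin d

/-- `x` is the (Carathéodory) state trajectory on `[0, ∞)` with `x(0) = x₀` under the input `u` and
the disturbance `d`: it is continuous and satisfies the integrated state equation. For locally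
integrable `u` and `d`, the integrand is locally integrable and `x` is unique on `[0, ∞)`. -/
def IsTrajectory (S : LTISystem n m q p) (x₀ : EuclideanSpace ℝ (Fin n))
    (u : ℝ → EuclideanSpace ℝ (Fin m)) (d : ℝ → EuclideanSpace ℝ (Fin q))
    (x : ℝ → EuclideanSpace ℝ (Fin n)) : Prop :=
  ContinuousOn x (Set.Ici 0) ∧
    ∀ t : ℝ, 0 ≤ t → x t = x₀ + ∫ s in (0 : ℝ)..t, S.vectorField (x s) (u s) (d s)

/-- The output `y = C x`. -/
def output (S : LTISystem n m q p) (x : ℝ → EuclideanSpace ℝ (Fin n)) :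
    ℝ → EuclideanSpace ℝ (Fin p) :=
  fun t => S.C.toEuclideanLin (x t)

end LTISystem

variable {n₁ n₂ m q₁ q₂ p : ℕ}

/-- `S₂` is `(γ, δ)`-similar to `S₁`, for possibly unstable systems and arbitrary initial
conditions. The constants `ε, η, μ` and the matrix `K` depend neither on the initial conditions nor
on the signals. -/
def IsSimilar (S₁ : LTISystem n₁ m q₁ p) (S₂ : LTISystem n₂ m q₂ p) (γ δ : ℝ) : Prop :=
  ∃ (ε η μ : ℝ) (K : Matrix (Fin n₁ ⊕ Fin n₂) (Fin n₁ ⊕ Fin n₂) ℝ),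
    0 < ε ∧ 0 < η ∧ 0 < μ ∧ K.PosDef ∧
    ∀ (x₁₀ : EuclideanSpace ℝ (Fin n₁)) (x₂₀ : EuclideanSpace ℝ (Fin n₂))
      (u₁ u₂ : ℝ → EuclideanSpace ℝ (Fin m)) (d₁ : ℝ → EuclideanSpace ℝ (Fin q₁)),
      IsL2 u₁ → IsL2 u₂ → IsL2 d₁ →
      ∃ (d₂ : ℝ → EuclideanSpace ℝ (Fin q₂))
        (x₁ : ℝ → EuclideanSpace ℝ (Fin n₁)) (x₂ : ℝ → EuclideanSpace ℝ (Fin n₂)),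
        IsL2 d₂ ∧ S₁.IsTrajectory x₁₀ u₁ d₁ x₁ ∧ S₂.IsTrajectory x₂₀ u₂ d₂ x₂ ∧
        IsL2 (fun t => S₁.output x₁ t - S₂.output x₂ t) ∧
        l2NormSq (fun t => S₁.output x₁ t - S₂.output x₂ t) ≤
          γ * l2NormSq (fun t => u₁ t - u₂ t)
            + (δ - ε) * l2NormSq (fun t => stack (u₁ t) (u₂ t))
            + (μ - ε) * l2NormSq d₁ - η * l2NormSq d₂
            + (stack x₁₀ x₂₀).ofLp ⬝ᵥ K *ᵥ (stack x₁₀ x₂₀).ofLp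

/-! The matrices of the composite system `ẋ = A x + B d₂ + E w`, `z = C x + D d₂`, where
`x = col(x₁, x₂)`, `w = col(u₁, u₂, d₁)` and `z = col(y₁ - y₂, d₂)`. -/

def compositeA (S₁ : LTISystem n₁ m q₁ p) (S₂ : LTISystem n₂ m q₂ p) :
    Matrix (Fin n₁ ⊕ Fin n₂) (Fin n₁ ⊕ Fin n₂) ℝ :=
  fromBlocks S₁.A 0 0 S₂.A

def compositeB (_S₁ : LTISystem n₁ m q₁ p) (S₂ : LTISystem n₂ m q₂ p) :
    Matrix (Fin n₁ ⊕ Fin n₂) (Fin q₂) ℝ :=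
  fromRows 0 S₂.E

def compositeE (S₁ : LTISystem n₁ m q₁ p) (S₂ : LTISystem n₂ m q₂ p) :
    Matrix (Fin n₁ ⊕ Fin n₂) ((Fin m ⊕ Fin m) ⊕ Fin q₁) ℝ :=
  fromRows (fromCols (fromCols S₁.B 0) S₁.E) (fromCols (fromCols 0 S₂.B) 0)

def compositeC (S₁ : LTISystem n₁ m q₁ p) (S₂ : LTISystem n₂ m q₂ p) :
    Matrix (Fin p ⊕ Fin q₂) (Fin n₁ ⊕ Fin n₂) ℝ :=
  fromBlocks S₁.C (-S₂.C) 0 0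

def compositeD (_S₁ : LTISystem n₁ m q₁ p) (_S₂ : LTISystem n₂ m q₂ p) :
    Matrix (Fin p ⊕ Fin q₂) (Fin q₂) ℝ :=
  fromRows 0 1

/-- The weight `Q` on `w = col(u₁, u₂, d₁)`. -/
def weightQ (m q₁ : ℕ) (γ δ μ : ℝ) :
    Matrix ((Fin m ⊕ Fin m) ⊕ Fin q₁) ((Fin m ⊕ Fin m) ⊕ Fin q₁) ℝ :=
  fromBlocks
    (fromBlocks ((γ + δ) • 1) (-(γ • 1)) (-(γ • 1)) ((γ + δ) • 1)) 0
    0 (μ • 1)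

/-- The weight `R` on `z = col(y₁ - y₂, d₂)`. -/
def weightR (p q₂ : ℕ) (η : ℝ) : Matrix (Fin p ⊕ Fin q₂) (Fin p ⊕ Fin q₂) ℝ :=
  fromBlocks 1 0 0 (η • 1)

/-- The symmetric `3 × 3` block matrix of the linear matrix inequality, with block rows
`[A X + B Π + (A X + B Π)ᵀ, E, (C X + D Π)ᵀ]`, `[Eᵀ, -Q, 0]` and `[C X + D Π, 0, -R]`. -/
def lmiMatrix (S₁ : LTISystem n₁ m q₁ p) (S₂ : LTISystem n₂ m q₂ p) (γ δ η μ : ℝ)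
    (X : Matrix (Fin n₁ ⊕ Fin n₂) (Fin n₁ ⊕ Fin n₂) ℝ)
    (P : Matrix (Fin q₂) (Fin n₁ ⊕ Fin n₂) ℝ) :
    Matrix (((Fin n₁ ⊕ Fin n₂) ⊕ ((Fin m ⊕ Fin m) ⊕ Fin q₁)) ⊕ (Fin p ⊕ Fin q₂))
      (((Fin n₁ ⊕ Fin n₂) ⊕ ((Fin m ⊕ Fin m) ⊕ Fin q₁)) ⊕ (Fin p ⊕ Fin q₂)) ℝ :=
  let A := compositeA S₁ S₂
  let B := compositeB S₁ S₂
  let E := compositeE S₁ S₂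
  let C := compositeC S₁ S₂
  let D := compositeD S₁ S₂
  fromBlocks
    (fromBlocks (A * X + B * P + (A * X + B * P)ᵀ) E Eᵀ (-weightQ m q₁ γ δ μ))
    (fromRows (C * X + D * P)ᵀ 0)
    (fromCols (C * X + D * P) 0)
    (-weightR p q₂ η)

end

/-! The feedback `d₂ = Π X⁻¹ x` works for all data, with storage function `V(x) = xᵀ X⁻¹ x`.
Evaluating the LMI at `v = X⁻¹ x`, `w = col(u₁, u₂, d₁)` and `R⁻¹ z` gives `V̇ + |y₁ - y₂|² + η⁻¹
|d₂|² ≤ wᵀ Q w - ε |w|²`, where `ε` comes from strictness (`exists_pos_dissipation_le`). Integrating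
over `[0, T]`, dropping `V(x(T)) ≥ 0` and letting `T → ∞` yields both square integrability of `y₁ -
y₂` and `d₂` and the required bound, with `K = X⁻¹` and `η⁻¹` in the role of `η`. No separate
stability argument for the closed loop is needed. Since inputs are merely `𝓛₂`, trajectories are
only absolutely continuous; `intervalIntegrable_and_dotProduct_mulVec_sub_eq_integral` is the chain
rule for `V` in that setting. -/

/-! ### Calculus along absolutely continuous trajectories. -/

theorem absolutelyContinuousOnInterval_const_add_integral {f : ℝ → ℝ} {a b : ℝ} (c : ℝ)
    (hf : IntervalIntegrable f volume a b) :
    AbsolutelyContinuousOnInterval (fun t => c + ∫ s in a..t, f s) a b := by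
  have h := hf.absolutelyContinuousOnInterval_intervalIntegral (c := a) (by simp)
  have hc : AbsolutelyContinuousOnInterval (fun _ : ℝ => c) a b :=
    (LipschitzWith.const c).lipschitzOnWith.absolutelyContinuousOnInterval
  exact hc.fun_add h

/-- Integration by parts for absolutely continuous functions; by Lebesgue differentiation their
derivatives are `f` and `g` almost everywhere. -/
theorem integral_mul_add_mul_of_eq_integral {f g F G : ℝ → ℝ} {a b : ℝ} (hab : a ≤ b)
    (hf : IntervalIntegrable f volume a b) (hg : IntervalIntegrable g volume a b)
    (hF : ∀ t ∈ Set.Icc a b, F t = F a + ∫ s in a..t, f s)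
    (hG : ∀ t ∈ Set.Icc a b, G t = G a + ∫ s in a..t, g s) :
    ∫ t in a..b, (f t * G t + F t * g t) = F b * G b - F a * G a := by
  have h := (absolutelyContinuousOnInterval_const_add_integral (F a)
    hf).integral_deriv_mul_eq_sub (absolutelyContinuousOnInterval_const_add_integral (G a) hg)
  rw [hF b ⟨hab, le_rfl⟩, hG b ⟨hab, le_rfl⟩]
  simp only [intervalIntegral.integral_same, add_zero] at h
  rw [← h]
  apply intervalIntegral.integral_congr_ae
  filter_upwards [hf.ae_hasDerivAt_integral, hg.ae_hasDerivAt_integral] with t h1 h2 ht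
  have ht' : t ∈ Set.uIcc a b := Set.uIoc_subset_uIcc ht
  have h3 := ((h1 ht' a (by simp)).const_add (F a)).deriv
  have h4 := ((h2 ht' a (by simp)).const_add (G a)).deriv
  rw [h3, h4, hF t (by rwa [Set.uIcc_of_le hab] at ht'),
    hG t (by rwa [Set.uIcc_of_le hab] at ht')]

/-- Expanding the form into entries `K i j` reduces it to the scalar product rule for pairs of
coordinates, so symmetry of `K` plays no role. -/
theorem intervalIntegrable_and_dotProduct_mulVec_sub_eq_integral {ι : Type} [Fintype ι] (K : Matrix ι ι ℝ)
    {x f : ℝ → EuclideanSpace ℝ ι} {a b : ℝ} (hab : a ≤ b)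
    (hf : IntervalIntegrable f volume a b) (hx : ∀ t ∈ Set.Icc a b, x t = x a + ∫ s in a..t, f s) :
    IntervalIntegrable (fun t => (f t).ofLp ⬝ᵥ K *ᵥ (x t).ofLp + (x t).ofLp ⬝ᵥ K *ᵥ (f t).ofLp)
        volume a b ∧
      (x b).ofLp ⬝ᵥ K *ᵥ (x b).ofLp - (x a).ofLp ⬝ᵥ K *ᵥ (x a).ofLp =
        ∫ t in a..b, ((f t).ofLp ⬝ᵥ K *ᵥ (x t).ofLp + (x t).ofLp ⬝ᵥ K *ᵥ (f t).ofLp) := by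
  have hfi : ∀ i, IntervalIntegrable (fun t => f t i) volume a b := fun i =>
    ⟨(EuclideanSpace.proj (𝕜 := ℝ) i).integrable_comp hf.1,
      (EuclideanSpace.proj (𝕜 := ℝ) i).integrable_comp hf.2⟩
  have hxi : ∀ i, ∀ t ∈ Set.Icc a b, x t i = x a i + ∫ s in a..t, f s i := by
    intro i t ht
    have hft : IntervalIntegrable f volume a t := hf.mono_set (by
      rw [Set.uIcc_of_le hab, Set.uIcc_of_le ht.1]; exact Set.Icc_subset_Icc_right ht.2)
    have := (EuclideanSpace.proj (𝕜 := ℝ) i).intervalIntegral_comp_comm hft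
    rw [hx t ht, PiLp.add_apply]
    exact congrArg (x a i + ·) this.symm
  have hxc : ∀ i, ContinuousOn (fun t => x t i) (Set.uIcc a b) := fun i =>
    (absolutelyContinuousOnInterval_const_add_integral (x a i) (hfi i)).continuousOn.congr
      (by rw [Set.uIcc_of_le hab]; exact hxi i)
  have hint : ∀ i j, IntervalIntegrable (fun t => K i j * (f t i * x t j + x t i * f t j))
      volume a b := fun i j =>
    (((hfi i).mul_continuousOn (hxc j)).add ((hfi j).continuousOn_mul (hxc i))).const_mul _
  have key : ∀ i j, ∫ t in a..b, K i j * (f t i * x t j + x t i * f t j) =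
      K i j * (x b i * x b j - x a i * x a j) := fun i j => by
    rw [intervalIntegral.integral_const_mul,
      integral_mul_add_mul_of_eq_integral hab (hfi i) (hfi j) (hxi i) (hxi j)]
  have e : ∀ u v : ι → ℝ, u ⬝ᵥ K *ᵥ v = ∑ i, ∑ j, K i j * (u i * v j) := fun u v => by
    simp only [dotProduct, mulVec, Finset.mul_sum]
    exact Finset.sum_congr rfl fun i _ => Finset.sum_congr rfl fun j _ => by ring
  simp only [e, ← Finset.sum_sub_distrib, ← Finset.sum_add_distrib, ← mul_sub, ← mul_add]
  have hsum : ∀ i, IntervalIntegrable (fun t => ∑ j, K i j * (f t i * x t j + x t i * f t j))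
      volume a b := fun i => by
    simpa only [Finset.sum_fn] using IntervalIntegrable.sum Finset.univ fun j _ => hint i j
  refine ⟨by simpa only [Finset.sum_fn] using
    IntervalIntegrable.sum Finset.univ fun i _ => hsum i, ?_⟩
  rw [intervalIntegral.integral_finsetSum fun i _ => hsum i]
  refine Finset.sum_congr rfl fun i _ => ?_
  rw [intervalIntegral.integral_finsetSum (fun j _ => hint i j)]
  exact Finset.sum_congr rfl fun j _ => (key i j).symm

/-- Variation of constants for a continuous linear equation with integrable forcing. -/
theorem exists_continuous_eq_add_integral {V : Type*} [NormedAddCommGroup V] [NormedSpace ℝ V]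
    [CompleteSpace V] (L : V →L[ℝ] V) {g : ℝ → V}
    (hg : ∀ a b, IntervalIntegrable g volume a b) (x₀ : V) :
    ∃ x : ℝ → V, Continuous x ∧ ∀ t, x t = x₀ + ∫ s in (0 : ℝ)..t, (L (x s) + g s) := by
  -- With `x = z + W` the rough forcing is absorbed: `z' = L z + L W` has continuous forcing, so `z`
  -- is differentiable everywhere and the classical formula applies.
  set W : ℝ → V := fun t => ∫ s in (0 : ℝ)..t, g s with hW
  have hWc : Continuous W := intervalIntegral.continuous_primitive hg 0
  set Φ : ℝ → V →L[ℝ] V := fun t => NormedSpace.exp (t • L) with hΦ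
  have hΦd : ∀ t, HasDerivAt Φ (L * Φ t) t := fun t => hasDerivAt_exp_smul_const' L t
  have hΦc : Continuous Φ := continuous_iff_continuousAt.2 fun t => (hΦd t).continuousAt
  have hΦinv : ∀ t, Φ t * Φ (-t) = 1 := fun t => by
    let _ : NormedAlgebra ℚ (V →L[ℝ] V) := NormedAlgebra.restrictScalars ℚ ℝ _
    simp only [hΦ]
    rw [← NormedSpace.exp_add_of_commute]
    · simp
    · exact ((Commute.refl L).smul_left _).smul_right _
  set h : ℝ → V := fun t => Φ (-t) (L (W t)) with hh
  have hhc : Continuous h := (hΦc.comp continuous_neg).clm_apply (L.continuous.comp hWc)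
  set z : ℝ → V := fun t => Φ t (x₀ + ∫ s in (0 : ℝ)..t, h s) with hz
  have hzd : ∀ t, HasDerivAt z (L (z t + W t)) t := fun t => by
    have h1 := (intervalIntegral.integral_hasDerivAt_right (hhc.intervalIntegrable 0 t)
      (hhc.stronglyMeasurableAtFilter _ _) hhc.continuousAt).const_add x₀
    have h2 := (hΦd t).clm_apply h1
    convert h2 using 1
    have h3 : Φ t (h t) = L (W t) := by
      have := congrArg (fun T : V →L[ℝ] V => T (L (W t))) (hΦinv t)
      simpa using this
    rw [h3, map_add]
    rfl
  have hzc : Continuous z := continuous_iff_continuousAt.2 fun t => (hzd t).continuousAt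
  refine ⟨fun t => z t + W t, hzc.add hWc, fun t => ?_⟩
  have hLc : Continuous fun s => L (z s + W s) := L.continuous.comp (hzc.add hWc)
  rw [intervalIntegral.integral_add (hLc.intervalIntegrable _ _) (hg _ _),
    intervalIntegral.integral_eq_sub_of_hasDerivAt (fun s _ => hzd s) (hLc.intervalIntegrable _ _)]
  have h0 : z 0 = x₀ := by simp [hz, hΦ]
  rw [h0]
  simp only [hW]
  abel

/-! ### Quadratic forms and the pointwise dissipation inequality. -/

theorem EuclideanSpace.dotProduct_self_eq_norm_sq {ι : Type*} [Fintype ι]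
    (v : EuclideanSpace ℝ ι) : v.ofLp ⬝ᵥ v.ofLp = ‖v‖ ^ 2 := by
  rw [EuclideanSpace.real_norm_sq_eq]
  exact Finset.sum_congr rfl fun i _ => (sq _).symm

/-- The constant is the minimum of the form on the compact unit sphere; homogeneity does the rest.
This is the source of the margin `ε`. -/
theorem Matrix.PosDef.exists_pos_mul_dotProduct_le {ι : Type*} [Fintype ι] {M : Matrix ι ι ℝ}
    (hM : M.PosDef) : ∃ c : ℝ, 0 < c ∧ ∀ v : ι → ℝ, c * (v ⬝ᵥ v) ≤ v ⬝ᵥ M *ᵥ v := by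
  have hcont : Continuous fun v : EuclideanSpace ℝ ι => v.ofLp ⬝ᵥ M *ᵥ v.ofLp := by
    simp only [dotProduct, mulVec]
    fun_prop
  rcases isEmpty_or_nonempty ι with hι | hι
  · exact ⟨1, one_pos, fun v => by simp [dotProduct]⟩
  obtain ⟨v₀, hv₀, hmin⟩ := (isCompact_sphere (0 : EuclideanSpace ℝ ι) 1).exists_isMinOn
    (NormedSpace.sphere_nonempty.2 zero_le_one) hcont.continuousOn
  have hv₀ne : v₀.ofLp ≠ 0 := fun h => by
    have h1 := EuclideanSpace.dotProduct_self_eq_norm_sq v₀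
    rw [mem_sphere_zero_iff_norm.1 hv₀, h] at h1
    simp at h1
  refine ⟨v₀.ofLp ⬝ᵥ M *ᵥ v₀.ofLp, by simpa using hM.dotProduct_mulVec_pos hv₀ne, fun v => ?_⟩
  rcases eq_or_ne v 0 with rfl | hv
  · simp
  set w : EuclideanSpace ℝ ι := WithLp.toLp 2 v with hw
  have hw0 : 0 < ‖w‖ := norm_pos_iff.2 fun h => hv (by simpa [hw] using h)
  have h1 := hmin (a := ‖w‖⁻¹ • w) (by simp [norm_smul, hw0.ne'])
  simp only [Set.mem_ofPred_eq, WithLp.ofLp_smul, mulVec_smul, smul_dotProduct,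
    dotProduct_smul, smul_eq_mul] at h1
  have h2 : v ⬝ᵥ v = ‖w‖ ^ 2 :=
    EuclideanSpace.dotProduct_self_eq_norm_sq w
  rw [h2]
  calc _ ≤ ‖w‖⁻¹ * (‖w‖⁻¹ * (v ⬝ᵥ M *ᵥ v)) * ‖w‖ ^ 2 := by gcongr
    _ = _ := by field_simp

theorem dotProduct_fromBlocks_lmi {ι ω κ : Type*} [Fintype ι] [Fintype ω] [Fintype κ]
    (G : Matrix ι ι ℝ) (E : Matrix ι ω ℝ) (H : Matrix κ ι ℝ) (Q : Matrix ω ω ℝ)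
    (R : Matrix κ κ ℝ) (v : ι → ℝ) (w : ω → ℝ) (z : κ → ℝ) :
    Sum.elim (Sum.elim v w) z ⬝ᵥ
      fromBlocks (fromBlocks (G + Gᵀ) E Eᵀ (-Q)) (fromRows Hᵀ 0) (fromCols H 0) (-R) *ᵥ
        Sum.elim (Sum.elim v w) z =
      2 * (v ⬝ᵥ G *ᵥ v) + 2 * (v ⬝ᵥ E *ᵥ w) + 2 * (z ⬝ᵥ H *ᵥ v) - w ⬝ᵥ Q *ᵥ w - z ⬝ᵥ R *ᵥ z := by
  have hG : v ⬝ᵥ Gᵀ *ᵥ v = v ⬝ᵥ G *ᵥ v := by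
    rw [mulVec_transpose, dotProduct_comm, dotProduct_mulVec]
  have hE : w ⬝ᵥ Eᵀ *ᵥ v = v ⬝ᵥ E *ᵥ w := by
    rw [mulVec_transpose, dotProduct_comm, dotProduct_mulVec]
  have hH : v ⬝ᵥ Hᵀ *ᵥ z = z ⬝ᵥ H *ᵥ v := by
    rw [mulVec_transpose, dotProduct_comm, dotProduct_mulVec]
  simp only [fromBlocks_mulVec, Sum.elim_comp_inl, Sum.elim_comp_inr, fromRows_mulVec,
    fromCols_mulVec_sumElim, sumElim_dotProduct_sumElim, dotProduct_add, add_mulVec, neg_mulVec,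
    dotProduct_neg, zero_mulVec, dotProduct_zero, hG, hE, hH]
  simp only [add_zero]
  ring

theorem dotProduct_weightQ_mulVec {m q₁ : ℕ} (γ δ μ : ℝ) (u₁ u₂ : Fin m → ℝ) (d₁ : Fin q₁ → ℝ) :
    Sum.elim (Sum.elim u₁ u₂) d₁ ⬝ᵥ weightQ m q₁ γ δ μ *ᵥ Sum.elim (Sum.elim u₁ u₂) d₁ =
      γ * ((u₁ - u₂) ⬝ᵥ (u₁ - u₂)) + δ * (u₁ ⬝ᵥ u₁ + u₂ ⬝ᵥ u₂) + μ * (d₁ ⬝ᵥ d₁) := by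
  simp only [weightQ, fromBlocks_mulVec, Sum.elim_comp_inl, Sum.elim_comp_inr,
    sumElim_dotProduct_sumElim, dotProduct_add, zero_mulVec, dotProduct_zero, smul_mulVec,
    one_mulVec, neg_mulVec, dotProduct_neg, dotProduct_smul, smul_eq_mul, sub_dotProduct,
    dotProduct_sub, dotProduct_comm u₂ u₁]
  ring

theorem dotProduct_weightR_mulVec {p q₂ : ℕ} (η : ℝ) (y : Fin p → ℝ) (d : Fin q₂ → ℝ) :
    Sum.elim y d ⬝ᵥ weightR p q₂ η *ᵥ Sum.elim y d = y ⬝ᵥ y + η * (d ⬝ᵥ d) := by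
  simp [weightR, fromBlocks_mulVec, smul_mulVec]

/-- The linear matrix inequality makes `x ↦ xᵀ X⁻¹ x` a strict storage function of the composite
system under the feedback `d₂ = Π X⁻¹ x`. -/
theorem exists_pos_dissipation_le {n₁ n₂ m q₁ q₂ p : ℕ}
    (S₁ : LTISystem n₁ m q₁ p) (S₂ : LTISystem n₂ m q₂ p) {γ δ η μ : ℝ}
    {X : Matrix (Fin n₁ ⊕ Fin n₂) (Fin n₁ ⊕ Fin n₂) ℝ}
    {P : Matrix (Fin q₂) (Fin n₁ ⊕ Fin n₂) ℝ} (hX : X.PosDef) (hη : 0 < η)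
    (hM : (-lmiMatrix S₁ S₂ γ δ η μ X P).PosDef) :
    ∃ ε : ℝ, 0 < ε ∧ ∀ (x f : Fin n₁ ⊕ Fin n₂ → ℝ) (u₁ u₂ : Fin m → ℝ) (d₁ : Fin q₁ → ℝ)
      (d₂ : Fin q₂ → ℝ) (y : Fin p → ℝ), d₂ = (P * X⁻¹) *ᵥ x →
      f = compositeA S₁ S₂ *ᵥ x + compositeB S₁ S₂ *ᵥ d₂
        + compositeE S₁ S₂ *ᵥ Sum.elim (Sum.elim u₁ u₂) d₁ →
      Sum.elim y d₂ = compositeC S₁ S₂ *ᵥ x + compositeD S₁ S₂ *ᵥ d₂ →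
      f ⬝ᵥ X⁻¹ *ᵥ x + x ⬝ᵥ X⁻¹ *ᵥ f + y ⬝ᵥ y + η⁻¹ * (d₂ ⬝ᵥ d₂) ≤
        γ * ((u₁ - u₂) ⬝ᵥ (u₁ - u₂)) + (δ - ε) * (u₁ ⬝ᵥ u₁ + u₂ ⬝ᵥ u₂)
          + (μ - ε) * (d₁ ⬝ᵥ d₁) := by
  obtain ⟨ε, hε, hle⟩ := hM.exists_pos_mul_dotProduct_le
  refine ⟨ε, hε, fun x f u₁ u₂ d₁ d₂ y hd₂ hf hy => ?_⟩
  set v := X⁻¹ *ᵥ x with hv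
  have hXv : X *ᵥ v = x := by
    rw [hv, mulVec_mulVec, mul_nonsing_inv _ hX.det_pos.ne'.isUnit, one_mulVec]
  have hPv : P *ᵥ v = d₂ := by rw [hv, mulVec_mulVec, hd₂]
  have hsymm : x ⬝ᵥ X⁻¹ *ᵥ f = f ⬝ᵥ v := by
    have hT : (X⁻¹)ᵀ = X⁻¹ := by simpa using hX.inv.isHermitian.eq
    rw [hv, dotProduct_mulVec, ← mulVec_transpose, hT, dotProduct_comm]
  -- The last slot is `R⁻¹ z`, the maximiser of `2 ζᵀ z - ζᵀ R ζ`, with value `|y|² + η⁻¹ |d₂|²`.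
  -- This replaces a Schur complement.
  have h := hle (Sum.elim (Sum.elim v (Sum.elim (Sum.elim u₁ u₂) d₁)) (Sum.elim y (η⁻¹ • d₂)))
  rw [neg_mulVec, dotProduct_neg, lmiMatrix, dotProduct_fromBlocks_lmi, dotProduct_weightQ_mulVec,
    dotProduct_weightR_mulVec] at h
  simp only [add_mulVec, ← mulVec_mulVec, hXv, hPv, ← hy, sumElim_dotProduct_sumElim,
    smul_dotProduct, dotProduct_smul, smul_eq_mul] at h
  have hfv : f ⬝ᵥ v = v ⬝ᵥ (compositeA S₁ S₂ *ᵥ x + compositeB S₁ S₂ *ᵥ d₂)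
      + v ⬝ᵥ compositeE S₁ S₂ *ᵥ Sum.elim (Sum.elim u₁ u₂) d₁ := by
    rw [hf, dotProduct_comm, dotProduct_add]
  have hηη : η * (η⁻¹ * (η⁻¹ * (d₂ ⬝ᵥ d₂))) = η⁻¹ * (d₂ ⬝ᵥ d₂) := by field_simp
  have nn : ∀ {k : Type} [Fintype k] (a : k → ℝ), 0 ≤ a ⬝ᵥ a := fun a =>
    Finset.sum_nonneg fun i _ => mul_self_nonneg _
  -- Of the margin `ε |·|²` only the part in `u₁, u₂, d₁` is kept; the rest is discarded.
  have h1 : 0 ≤ ε * (v ⬝ᵥ v) := mul_nonneg hε.le (nn v)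
  have h2 : 0 ≤ ε * (y ⬝ᵥ y) := mul_nonneg hε.le (nn y)
  have h3 : 0 ≤ ε * (η⁻¹ * (η⁻¹ * (d₂ ⬝ᵥ d₂))) := by have := nn d₂; positivity
  rw [hsymm]
  linarith

/-! ### Square-integrable signals and passage to the infinite horizon. -/

theorem norm_stack_sq {ι κ : Type} [Fintype ι] [Fintype κ] (x : EuclideanSpace ℝ ι)
    (y : EuclideanSpace ℝ κ) : ‖stack x y‖ ^ 2 = ‖x‖ ^ 2 + ‖y‖ ^ 2 := by
  simp [stack, EuclideanSpace.real_norm_sq_eq]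

theorem continuous_stack {ι κ : Type} [Fintype ι] [Fintype κ] :
    Continuous fun z : EuclideanSpace ℝ ι × EuclideanSpace ℝ κ => stack z.1 z.2 := by
  refine (PiLp.continuous_toLp 2 _).comp (continuous_pi fun i => ?_)
  cases i <;> simp only [Sum.elim_inl, Sum.elim_inr] <;> fun_prop

namespace IsL2

variable {ι κ : Type} [Fintype ι] [Fintype κ]

theorem integrableOn_norm_sq {u : ℝ → EuclideanSpace ℝ ι} (hu : IsL2 u) :
    IntegrableOn (fun t => ‖u t‖ ^ 2) (Set.Ici 0) :=
  (memLp_two_iff_integrable_sq_norm hu.1).1 hu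

theorem stack {u : ℝ → EuclideanSpace ℝ ι} {v : ℝ → EuclideanSpace ℝ κ} (hu : IsL2 u)
    (hv : IsL2 v) : IsL2 fun t => _root_.stack (u t) (v t) := by
  refine (memLp_two_iff_integrable_sq_norm
    (continuous_stack.comp_aestronglyMeasurable (hu.1.prodMk hv.1))).2 ?_
  simp only [norm_stack_sq]
  exact hu.integrableOn_norm_sq.add hv.integrableOn_norm_sq

theorem intervalIntegrable_indicator {u : ℝ → EuclideanSpace ℝ ι} (hu : IsL2 u) (a b : ℝ) :
    IntervalIntegrable ((Set.Ici 0).indicator u) volume a b :=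
  (((memLp_indicator_iff_restrict measurableSet_Ici).2 hu).locallyIntegrable
    (by norm_num) |>.integrableOn_isCompact isCompact_uIcc).intervalIntegrable

end IsL2

/-- If the partial integrals of a continuous nonnegative function are dominated by those of an
integrable one up to a constant, then so is the full integral. -/
theorem integrableOn_and_integral_le_of_forall_intervalIntegral_le {φ ρ : ℝ → ℝ} {c : ℝ}
    (hφ : Continuous φ) (hφ0 : ∀ t, 0 ≤ φ t) (hρ : IntegrableOn ρ (Set.Ici 0))
    (h : ∀ T, 0 ≤ T → ∫ t in (0 : ℝ)..T, φ t ≤ (∫ t in (0 : ℝ)..T, ρ t) + c) :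
    IntegrableOn φ (Set.Ici 0) ∧ ∫ t in Set.Ici (0 : ℝ), φ t ≤ (∫ t in Set.Ici (0 : ℝ), ρ t) + c := by
  rw [integrableOn_Ici_iff_integrableOn_Ioi] at hρ ⊢
  rw [integral_Ici_eq_integral_Ioi, integral_Ici_eq_integral_Ioi]
  have hlim := intervalIntegral_tendsto_integral_Ioi 0 hρ Filter.tendsto_id
  have hint : IntegrableOn φ (Set.Ioi 0) := by
    refine integrableOn_Ioi_of_intervalIntegral_norm_bounded
      ((∫ t in Set.Ioi (0 : ℝ), ρ t) + 1 + c) 0 (fun T => ?_) Filter.tendsto_id ?_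
    · exact (hφ.integrableOn_Icc).mono_set Set.Ioc_subset_Icc_self
    -- The partial integrals of `ρ` need not be monotone, but eventually lie below their limit plus
    -- one, which suffices for integrability of `φ`.
    · filter_upwards [hlim.eventually (gt_mem_nhds (lt_add_one _)), Filter.eventually_ge_atTop 0]
        with T hT hT0
      have h1 := h T hT0
      simp only [id, Real.norm_of_nonneg (hφ0 _)] at hT ⊢
      linarith
  refine ⟨hint, le_of_tendsto_of_tendsto
    (intervalIntegral_tendsto_integral_Ioi 0 hint Filter.tendsto_id) (hlim.add_const c) ?_⟩
  filter_upwards [Filter.eventually_ge_atTop 0] with T hT using h T hT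

/-- Restriction of a vector to a subset of its coordinates, as a continuous linear map. -/
noncomputable def EuclideanSpace.restrictCoords {ι κ : Type} [Fintype ι] [Fintype κ] (e : ι → κ) :
    EuclideanSpace ℝ κ →L[ℝ] EuclideanSpace ℝ ι :=
  LinearMap.toContinuousLinearMap
    { toFun := fun x => WithLp.toLp 2 (x.ofLp ∘ e)
      map_add' := fun _ _ => rfl
      map_smul' := fun _ _ => rfl }

theorem EuclideanSpace.restrictCoords_apply {ι κ : Type} [Fintype ι] [Fintype κ] (e : ι → κ)
    (x : EuclideanSpace ℝ κ) : restrictCoords e x = WithLp.toLp 2 (x.ofLp ∘ e) := rfl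

theorem ContinuousLinearMap.map_eq_add_intervalIntegral {V W : Type*} [NormedAddCommGroup V]
    [NormedSpace ℝ V] [CompleteSpace V] [NormedAddCommGroup W] [NormedSpace ℝ W] [CompleteSpace W]
    (L : V →L[ℝ] W) {x f : ℝ → V} {x₀ : V} {g : ℝ → W} {t : ℝ} (ht : 0 ≤ t)
    (hf : IntervalIntegrable f volume 0 t) (hx : x t = x₀ + ∫ s in (0 : ℝ)..t, f s)
    (hg : ∀ s, 0 ≤ s → L (f s) = g s) : L (x t) = L x₀ + ∫ s in (0 : ℝ)..t, g s := by
  rw [hx, map_add, ← L.intervalIntegral_comp_comm hf]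
  congr 1
  refine intervalIntegral.integral_congr fun s hs => hg s ?_
  rw [Set.uIcc_of_le ht] at hs
  exact hs.1

/-! ### Closed-loop trajectory and the similarity estimate. -/

theorem mainTheorem8 {n₁ n₂ m q₁ q₂ p : ℕ}
    (S₁ : LTISystem n₁ m q₁ p) (S₂ : LTISystem n₂ m q₂ p)
    (γ δ : ℝ) (hγ : 0 < γ) (hδ : 0 < δ)
    (hLMI : ∃ (X : Matrix (Fin n₁ ⊕ Fin n₂) (Fin n₁ ⊕ Fin n₂) ℝ)
      (P : Matrix (Fin q₂) (Fin n₁ ⊕ Fin n₂) ℝ) (η μ : ℝ),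
      X.PosDef ∧ 0 < η ∧ 0 < μ ∧ (-lmiMatrix S₁ S₂ γ δ η μ X P).PosDef) :
    IsSimilar S₁ S₂ γ δ := by
  obtain ⟨X, P, η, μ, hX, hη, hμ, hM⟩ := hLMI
  obtain ⟨ε, hε, hdiss⟩ := exists_pos_dissipation_le S₁ S₂ hX hη hM
  refine ⟨ε, η⁻¹, μ, X⁻¹, hε, inv_pos.2 hη, hμ, hX.inv, fun x₁₀ x₂₀ u₁ u₂ d₁ hu₁ hu₂ hd₁ => ?_⟩
  set F := P * X⁻¹ with hF
  set L := (compositeA S₁ S₂ + compositeB S₁ S₂ * F).toEuclideanLin.toContinuousLinearMap with hL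
  set w := fun t => stack (stack (u₁ t) (u₂ t)) (d₁ t) with hw
  -- Signals are arbitrary at negative times; cutting them off makes the forcing integrable on every
  -- interval.
  set g : ℝ → EuclideanSpace ℝ (Fin n₁ ⊕ Fin n₂) :=
    (Set.Ici 0).indicator (fun t => (compositeE S₁ S₂).toEuclideanLin (w t)) with hg
  have hgI : ∀ a b, IntervalIntegrable g volume a b := by
    have hwL : IsL2 w := (hu₁.stack hu₂).stack hd₁
    have h1 : IsL2 fun t => (compositeE S₁ S₂).toEuclideanLin (w t) :=
      (compositeE S₁ S₂).toEuclideanLin.toContinuousLinearMap.comp_memLp' hwL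
    exact h1.intervalIntegrable_indicator
  obtain ⟨x, hxc, hx⟩ := exists_continuous_eq_add_integral L hgI (stack x₁₀ x₂₀)
  set f := fun s => L (x s) + g s with hf
  have hfI : ∀ a b, IntervalIntegrable f volume a b := fun a b =>
    ((L.continuous.comp hxc).intervalIntegrable a b).add (hgI a b)
  have hx0 : x 0 = stack x₁₀ x₂₀ := by rw [hx 0]; simp
  set d₂ : ℝ → EuclideanSpace ℝ (Fin q₂) := fun t => F.toEuclideanLin (x t) with hd₂
  set x₁ := fun t => EuclideanSpace.restrictCoords Sum.inl (x t) with hx₁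
  set x₂ := fun t => EuclideanSpace.restrictCoords Sum.inr (x t) with hx₂
  set y := fun t => S₁.output x₁ t - S₂.output x₂ t with hy
  have hd₂c : Continuous d₂ := F.toEuclideanLin.continuous_of_finiteDimensional.comp hxc
  have hx₁c : Continuous x₁ := (EuclideanSpace.restrictCoords _).continuous.comp hxc
  have hx₂c : Continuous x₂ := (EuclideanSpace.restrictCoords _).continuous.comp hxc
  have hyc : Continuous y :=
    (S₁.C.toEuclideanLin.continuous_of_finiteDimensional.comp hx₁c).sub
      (S₂.C.toEuclideanLin.continuous_of_finiteDimensional.comp hx₂c)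
  have hfs : ∀ s, 0 ≤ s → (f s).ofLp = compositeA S₁ S₂ *ᵥ (x s).ofLp
      + compositeB S₁ S₂ *ᵥ (d₂ s).ofLp
      + compositeE S₁ S₂ *ᵥ Sum.elim (Sum.elim (u₁ s).ofLp (u₂ s).ofLp) (d₁ s).ofLp := by
    intro s hs
    have hgs : g s = (compositeE S₁ S₂).toEuclideanLin (w s) :=
      Set.indicator_of_mem (Set.mem_Ici.2 hs) _
    simp only [hf, hgs, WithLp.ofLp_add, hL, hd₂, LinearMap.coe_toContinuousLinearMap',
      ofLp_toLpLin, toLin'_apply, add_mulVec, mulVec_mulVec]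
    rfl
  have htraj₁ : S₁.IsTrajectory x₁₀ u₁ d₁ x₁ := by
    refine ⟨hx₁c.continuousOn, fun t ht => ?_⟩
    refine (EuclideanSpace.restrictCoords Sum.inl).map_eq_add_intervalIntegral ht (hfI 0 t) (hx t)
      fun s hs => ?_
    ext i
    simp [EuclideanSpace.restrictCoords_apply, hfs s hs, LTISystem.vectorField, compositeA,
      compositeB, compositeE, fromBlocks_mulVec, fromRows_mulVec, hx₁, add_assoc]
  have htraj₂ : S₂.IsTrajectory x₂₀ u₂ d₂ x₂ := by
    refine ⟨hx₂c.continuousOn, fun t ht => ?_⟩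
    refine (EuclideanSpace.restrictCoords Sum.inr).map_eq_add_intervalIntegral ht (hfI 0 t) (hx t)
      fun s hs => ?_
    ext i
    simp [EuclideanSpace.restrictCoords_apply, hfs s hs, LTISystem.vectorField, compositeA,
      compositeB, compositeE, fromBlocks_mulVec, fromRows_mulVec, hx₂]
    ring
  have hys : ∀ s, Sum.elim (y s).ofLp (d₂ s).ofLp = compositeC S₁ S₂ *ᵥ (x s).ofLp
      + compositeD S₁ S₂ *ᵥ (d₂ s).ofLp := by
    intro s
    ext i
    cases i <;> simp [compositeC, compositeD, fromBlocks_mulVec, fromRows_mulVec, hy,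
      LTISystem.output, hx₁, hx₂, EuclideanSpace.restrictCoords_apply,
      sub_eq_add_neg, neg_mulVec]
  set φ := fun t => ‖y t‖ ^ 2 + η⁻¹ * ‖d₂ t‖ ^ 2 with hφ
  set ρ := fun t => γ * ‖u₁ t - u₂ t‖ ^ 2 + (δ - ε) * ‖stack (u₁ t) (u₂ t)‖ ^ 2
    + (μ - ε) * ‖d₁ t‖ ^ 2 with hρ
  set V := fun t => (f t).ofLp ⬝ᵥ X⁻¹ *ᵥ (x t).ofLp + (x t).ofLp ⬝ᵥ X⁻¹ *ᵥ (f t).ofLp with hV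
  have hVle : ∀ s, 0 ≤ s → V s + φ s ≤ ρ s := by
    intro s hs
    have := hdiss (x s).ofLp _ _ _ _ (d₂ s).ofLp _ rfl (hfs s hs) (hys s)
    rw [← WithLp.ofLp_sub, EuclideanSpace.dotProduct_self_eq_norm_sq,
      EuclideanSpace.dotProduct_self_eq_norm_sq, EuclideanSpace.dotProduct_self_eq_norm_sq,
      EuclideanSpace.dotProduct_self_eq_norm_sq, EuclideanSpace.dotProduct_self_eq_norm_sq,
      EuclideanSpace.dotProduct_self_eq_norm_sq] at this
    simp only [hV, hφ, hρ, norm_stack_sq]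
    linarith
  have hu : IsL2 fun t => u₁ t - u₂ t := hu₁.sub hu₂
  have hI₁ := hu.integrableOn_norm_sq.const_mul γ
  have hI₂ := (hu₁.stack hu₂).integrableOn_norm_sq.const_mul (δ - ε)
  have hI₃ := hd₁.integrableOn_norm_sq.const_mul (μ - ε)
  have hρI : IntegrableOn ρ (Set.Ici 0) := (hI₁.add hI₂).add hI₃
  have hφc : Continuous φ := by fun_prop
  set c := (stack x₁₀ x₂₀).ofLp ⬝ᵥ X⁻¹ *ᵥ (stack x₁₀ x₂₀).ofLp with hc
  obtain ⟨hφI, hφle⟩ := integrableOn_and_integral_le_of_forall_intervalIntegral_le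
    (c := c) hφc
    (fun t => by positivity) hρI fun T hT => by
      obtain ⟨hVI, hVeq⟩ := intervalIntegrable_and_dotProduct_mulVec_sub_eq_integral X⁻¹
        (x := x) hT (hfI 0 T) fun t _ => by rw [hx0]; exact hx t
      have hρT : IntervalIntegrable ρ volume 0 T :=
        (hρI.mono_set (by rw [Set.uIcc_of_le hT]; exact Set.Icc_subset_Ici_self)).intervalIntegrable
      have h1 := intervalIntegral.integral_mono_on hT (hVI.add (hφc.intervalIntegrable 0 T)) hρT
        fun s hs => hVle s hs.1
      rw [intervalIntegral.integral_add hVI (hφc.intervalIntegrable 0 T), ← hVeq, hx0] at h1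
      -- The terminal storage is dropped, leaving the initial storage `c` as the only boundary term.
      have h2 : 0 ≤ (x T).ofLp ⬝ᵥ X⁻¹ *ᵥ (x T).ofLp := by
        simpa using hX.inv.posSemidef.dotProduct_mulVec_nonneg (x T).ofLp
      linarith
  have hyI : IntegrableOn (fun t => ‖y t‖ ^ 2) (Set.Ici 0) :=
    hφI.mono' (hyc.norm.pow 2).aestronglyMeasurable (.of_forall fun t => by
      rw [Real.norm_of_nonneg (by positivity)]
      exact le_add_of_nonneg_right (by positivity))
  have hdI : IntegrableOn (fun t => η⁻¹ * ‖d₂ t‖ ^ 2) (Set.Ici 0) :=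
    hφI.mono' (continuous_const.mul (hd₂c.norm.pow 2)).aestronglyMeasurable (.of_forall fun t => by
      rw [Real.norm_of_nonneg (by positivity)]
      exact le_add_of_nonneg_left (by positivity))
  have hdI' : IntegrableOn (fun t => ‖d₂ t‖ ^ 2) (Set.Ici 0) :=
    (integrable_const_mul_iff (inv_pos.2 hη).ne'.isUnit _).1 hdI
  refine ⟨d₂, x₁, x₂, (memLp_two_iff_integrable_sq_norm hd₂c.aestronglyMeasurable).2 hdI', htraj₁,
    htraj₂, (memLp_two_iff_integrable_sq_norm hyc.aestronglyMeasurable).2 hyI, ?_⟩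
  have e1 : ∫ t in Set.Ici (0 : ℝ), φ t = l2NormSq y + η⁻¹ * l2NormSq d₂ := by
    simp only [hφ]
    rw [integral_add hyI hdI, integral_const_mul]
    rfl
  have e2 : ∫ t in Set.Ici (0 : ℝ), ρ t = γ * l2NormSq (fun t => u₁ t - u₂ t)
      + (δ - ε) * l2NormSq (fun t => stack (u₁ t) (u₂ t)) + (μ - ε) * l2NormSq d₁ := by
    simp only [hρ]
    rw [integral_add (hI₁.fun_add hI₂) hI₃, integral_add hI₁ hI₂, integral_const_mul,
      integral_const_mul, integral_const_mul]
    rfl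
  linarith
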